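/- All rings are associative with a non-zero identity element. A module is \emph{distributive} if its lattice of submodules is distributive, and \emph{uniserial} if any two of its submodules are comparable with respect to inclusion. A ring $A$ is \emph{right distributive} (resp. \emph{right Noetherian}) if the right module $A_A$ is distributive (resp. Noetherian); $A$ is \emph{distributive}, \emph{uniserial}, \emph{Noetherian} or \emph{Artinian} if both modules $A_A$ and ${}_AA$ have the respective property. A ring $A$ is \emph{centrally essential} if for every non-zero $a\in A$ there are non-zero central elements $c,d\in A$ with $ac=d$. \textbf{Proposition.} A ring $A$ is right distributive, right Noetherian and centrally essential if and only if $A\cong A_1\times\cdots\times A_n$ for some $n\ge 1$ and rings $A_1,\ldots,A_n$, each of which is a uniserial Artinian centrally essential ring or a commutative Dedekind domain (fields being counted as Dedekind domains). Moreover, in this case $A$ is distributive and Noetherian. -/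

import Mathlib

universe u

/-- A module is distributive if its lattice of submodules is distributive. -/
def IsDistributiveModule (R M : Type*) [Ring R] [AddCommGroup M] [Module R M] : Prop :=
  ∀ X Y Z : Submodule R M, X ⊓ (Y ⊔ Z) = (X ⊓ Y) ⊔ (X ⊓ Z)

/-- A module is uniserial if any two of its submodules are comparable. -/
def IsUniserialModule (R M : Type*) [Ring R] [AddCommGroup M] [Module R M] : Prop :=
  ∀ X Y : Submodule R M, X ≤ Y ∨ Y ≤ X

/-- The right module `A_A` is distributive; right `A`-modules are `Aᵐᵒᵖ`-modules. -/
def IsRightDistributiveRing (A : Type*) [Ring A] : Prop := IsDistributiveModule Aᵐᵒᵖ A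

/-- Distributive on both sides. -/
def IsDistributiveRing (A : Type*) [Ring A] : Prop :=
  IsDistributiveModule Aᵐᵒᵖ A ∧ IsDistributiveModule A A

/-- Uniserial on both sides. -/
def IsUniserialRing (A : Type*) [Ring A] : Prop :=
  IsUniserialModule Aᵐᵒᵖ A ∧ IsUniserialModule A A

/-- The right module `A_A` is Noetherian. -/
def IsRightNoetherianRing (A : Type*) [Ring A] : Prop := IsNoetherian Aᵐᵒᵖ A

/-- Noetherian on both sides. -/
def IsTwoSidedNoetherianRing (A : Type*) [Ring A] : Prop :=
  IsNoetherian Aᵐᵒᵖ A ∧ IsNoetherian A A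

/-- Artinian on both sides. -/
def IsTwoSidedArtinianRing (A : Type*) [Ring A] : Prop :=
  IsArtinian Aᵐᵒᵖ A ∧ IsArtinian A A

/-- Every non-zero `a` has non-zero central elements `c`, `d` with `a * c = d`. -/
def IsCentrallyEssential (A : Type*) [Ring A] : Prop :=
  ∀ a : A, a ≠ 0 →
    ∃ c ∈ Subring.center A, ∃ d ∈ Subring.center A, c ≠ 0 ∧ d ≠ 0 ∧ a * c = d

/-- The ring `A` is commutative and, as a commutative ring, a Dedekind domain. -/
def IsCommutativeDedekindDomain (A : Type*) [inst : Ring A] : Prop :=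
  ∃ h : ∀ x y : A, x * y = y * x, @IsDedekindDomain A { inst with mul_comm := h }

/-- `A` is (isomorphic to) a finite direct product of non-zero rings, each of which is a uniserial
Artinian centrally essential ring or a commutative Dedekind domain. -/
def IsProductOfUniserialArtinianAndDedekind (A : Type u) [Ring A] : Prop :=
  ∃ (n : ℕ) (B : Fin n → Type u) (_ : ∀ i, Ring (B i)),
    (∀ i, Nontrivial (B i) ∧
      ((IsUniserialRing (B i) ∧ IsTwoSidedArtinianRing (B i) ∧ IsCentrallyEssential (B i)) ∨
        IsCommutativeDedekindDomain (B i))) ∧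
    Nonempty (A ≃+* ∀ i, B i)

/-! ### Distributive and uniserial modules -/

section Modules

variable {R M : Type*} [Ring R] [AddCommGroup M] [Module R M]

/-! Elementwise, right distributivity gives for each `a`, `b` an `x` with `a * x ∈ bA` and `b * (1 -
x) ∈ aA`. This passes to quotients and products and drives the proof. Idempotents of a centrally
essential ring are central, so Noetherian induction splits the ring into factors with only trivial
idempotents. In such a factor a Fitting argument makes every zero divisor nilpotent
(`isNilpotent_of_mul_eq_zero`).

If no nonzero central element is nilpotent, the factor is a commutative Noetherian domain, and the
criterion makes it integrally closed of dimension at most one. Otherwise the ascending chain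
condition, applied to principal ideals of central elements, makes every non-nilpotent element a unit
(`isNilpotent_or_isUnit`). Principal right ideals are then comparable, the nilpotents are `pA` for
some `p`, and central essentiality carries this generator to the left side
(`exists_eq_mul_generator`). Nonzero elements are units times powers of `p`, on either side.

Conversely, uniserial rings and Dedekind domains satisfy the criterion, Artinian rings are
Noetherian by Hopkins–Levitzki, and all properties pass to finite products. -/

theorem isDistributiveModule_iff : IsDistributiveModule R M ↔
    ∀ a b : M, ∃ r s t : R, r • a = s • b ∧ (1 - r) • b = t • a := by
  constructor
  · intro h a b
    -- Distributivity is tested on `a = b + (a - b)`; the scalars below come from `a = β b + γ a`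
    -- and `γ a = z (a - b)`.
    have ha : a ∈ Submodule.span R {a} ⊓ (Submodule.span R {b} ⊔ Submodule.span R {a - b}) := by
      refine ⟨Submodule.mem_span_singleton_self a, ?_⟩
      refine Submodule.mem_sup.2 ⟨b, Submodule.mem_span_singleton_self b, a - b,
        Submodule.mem_span_singleton_self _, by abel⟩
    rw [h] at ha
    obtain ⟨p, ⟨-, hpb⟩, q, ⟨hqa, hqab⟩, hpq⟩ := Submodule.mem_sup.1 ha
    obtain ⟨β, rfl⟩ := Submodule.mem_span_singleton.1 hpb
    obtain ⟨γ, rfl⟩ := Submodule.mem_span_singleton.1 hqa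
    obtain ⟨z, hz⟩ := Submodule.mem_span_singleton.1 hqab
    refine ⟨1 - z, β - z, z - γ, ?_, ?_⟩
    · rw [smul_sub] at hz
      rw [sub_smul, sub_smul, one_smul]
      nth_rewrite 1 [← hpq]
      rw [← hz]; abel
    · rw [sub_sub_cancel, sub_smul, ← hz, smul_sub]; abel
  · intro h X Y Z
    refine le_antisymm ?_ (sup_le (inf_le_inf_left _ le_sup_left) (inf_le_inf_left _ le_sup_right))
    rintro m ⟨hX, hYZ⟩
    obtain ⟨y, hy, z, hz, rfl⟩ := Submodule.mem_sup.1 hYZ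
    obtain ⟨r, s, t, h₁, h₂⟩ := h y z
    refine Submodule.mem_sup.2 ⟨(1 - r) • (y + z), ⟨X.smul_mem _ hX, ?_⟩, r • (y + z),
      ⟨X.smul_mem _ hX, ?_⟩, by rw [← add_smul, sub_add_cancel, one_smul]⟩
    · rw [smul_add, h₂]
      exact Y.add_mem (Y.smul_mem _ hy) (Y.smul_mem _ hy)
    · rw [smul_add, h₁]
      exact Z.add_mem (Z.smul_mem _ hz) (Z.smul_mem _ hz)

theorem IsUniserialModule.isDistributiveModule (h : IsUniserialModule R M) :
    IsDistributiveModule R M := by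
  refine isDistributiveModule_iff.2 fun a b => ?_
  rcases h (Submodule.span R {a}) (Submodule.span R {b}) with h | h
  · obtain ⟨s, hs⟩ := Submodule.mem_span_singleton.1 (h (Submodule.mem_span_singleton_self a))
    exact ⟨1, s, 0, by simp [hs], by simp⟩
  · obtain ⟨s, hs⟩ := Submodule.mem_span_singleton.1 (h (Submodule.mem_span_singleton_self b))
    exact ⟨0, 0, s, by simp, by simp [hs]⟩

variable {m : ℕ → M}

/-- All nonzero cyclic submodules lie in one descending chain, which makes arbitrary submodules
comparable. -/
theorem IsUniserialModule.of_chain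
    (hm : ∀ a : M, a ≠ 0 → ∃ k, ∃ r : R, IsUnit r ∧ a = r • m k)
    (hanti : ∀ k, m (k + 1) ∈ Submodule.span R {m k}) :
    IsUniserialModule R M := by
  have hanti' : Antitone fun k => Submodule.span R {m k} :=
    antitone_nat_of_succ_le fun k => (Submodule.span_singleton_le_iff_mem _ _).2 (hanti k)
  have hspan : ∀ a : M, a ≠ 0 → ∃ k, Submodule.span R {a} = Submodule.span R {m k} := by
    intro a ha
    obtain ⟨k, r, hr, rfl⟩ := hm a ha
    exact ⟨k, Submodule.span_singleton_smul_eq hr _⟩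
  intro X Y
  by_contra! hXY
  obtain ⟨a, haX, haY⟩ := Set.not_subset.1 hXY.1
  obtain ⟨b, hbY, hbX⟩ := Set.not_subset.1 hXY.2
  obtain ⟨k, hk⟩ := hspan a (by rintro rfl; exact haY Y.zero_mem)
  obtain ⟨l, hl⟩ := hspan b (by rintro rfl; exact hbX X.zero_mem)
  rcases le_total k l with h | h
  · apply hbX
    have : Submodule.span R {b} ≤ Submodule.span R {a} := by rw [hk, hl]; exact hanti' h
    exact (this.trans ((Submodule.span_singleton_le_iff_mem _ _).2 haX))
      (Submodule.mem_span_singleton_self b)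
  · apply haY
    have : Submodule.span R {a} ≤ Submodule.span R {b} := by rw [hk, hl]; exact hanti' h
    exact (this.trans ((Submodule.span_singleton_le_iff_mem _ _).2 hbY))
      (Submodule.mem_span_singleton_self a)

/-- A submodule is determined by which of the finitely many `m k`, `k < n`, it contains, so there
are only finitely many submodules. -/
theorem IsArtinian.of_chain {n : ℕ}
    (hm : ∀ a : M, a ≠ 0 → ∃ k, ∃ r : R, IsUnit r ∧ a = r • m k)
    (hn : ∀ k, n ≤ k → m k = 0) : IsArtinian R M := by
  have hle : ∀ X Y : Submodule R M, (∀ k : Fin n, m k ∈ X → m k ∈ Y) → X ≤ Y := by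
    intro X Y h a ha
    by_cases h0 : a = 0
    · rw [h0]; exact Y.zero_mem
    obtain ⟨k, r, hr, rfl⟩ := hm a h0
    refine Y.smul_mem _ ?_
    by_cases hk : k < n
    · exact h ⟨k, hk⟩ ((X.smul_mem_iff_of_isUnit hr).1 ha)
    · rw [hn k (not_lt.1 hk)]; exact Y.zero_mem
  have : Finite (Submodule R M) := by
    refine Finite.of_injective (fun X : Submodule R M => {k : Fin n | m k ∈ X}) fun X Y h => ?_
    have h' : ∀ k : Fin n, m k ∈ X ↔ m k ∈ Y := fun k => Set.ext_iff.1 h k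
    exact le_antisymm (hle X Y fun k => (h' k).1) (hle Y X fun k => (h' k).2)
  rw [IsArtinian]
  infer_instance

end Modules

theorem isRightDistributiveRing_iff {A : Type*} [Ring A] : IsRightDistributiveRing A ↔
    ∀ a b : A, ∃ x y z : A, a * x = b * y ∧ b * (1 - x) = a * z := by
  rw [IsRightDistributiveRing, isDistributiveModule_iff]
  refine forall₂_congr fun a b => ?_
  constructor
  · rintro ⟨r, s, t, h₁, h₂⟩
    exact ⟨r.unop, s.unop, t.unop, h₁, h₂⟩
  · rintro ⟨x, y, z, h₁, h₂⟩
    exact ⟨.op x, .op y, .op z, h₁, h₂⟩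

theorem isDistributiveModule_self_iff {A : Type*} [Ring A] : IsDistributiveModule A A ↔
    ∀ a b : A, ∃ x y z : A, x * a = y * b ∧ (1 - x) * b = z * a :=
  isDistributiveModule_iff

/-! ### Right Noetherian centrally essential rings -/

section CentrallyEssential

variable {A : Type*} [Ring A]

theorem mul_comm_of_mem_center {c : A} (hc : c ∈ Subring.center A) (a : A) : a * c = c * a :=
  Subring.mem_center_iff.1 hc a

/-- In a centrally essential ring, all idempotents are central. -/
theorem IsCentrallyEssential.commute_of_isIdempotentElem (hc : IsCentrallyEssential A) {e : A}
    (he : IsIdempotentElem e) (a : A) : e * a = a * e := by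
  have he' : e * e = e := he
  -- A nonzero central multiple `d` would satisfy `e * d = d` and `d * e = 0`.
  have h₁ : e * a * (1 - e) = 0 := by
    by_contra h
    obtain ⟨c, hcc, d, hd, -, hd0, hcd⟩ := hc _ h
    apply hd0
    have h1 : e * d = d := by rw [← hcd]; simp only [← mul_assoc, he']
    have h2 : d * e = 0 := by
      rw [← hcd, mul_assoc, ← mul_comm_of_mem_center hcc e, ← mul_assoc, mul_assoc _ (1 - e),
        sub_mul, he', one_mul, sub_self, mul_zero, zero_mul]
    rw [← h1, mul_comm_of_mem_center hd, h2]
  have h₂ : (1 - e) * a * e = 0 := by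
    by_contra h
    obtain ⟨c, hcc, d, hd, -, hd0, hcd⟩ := hc _ h
    apply hd0
    have h1 : d * e = d := by
      rw [← hcd, mul_assoc, ← mul_comm_of_mem_center hcc, mul_assoc _ e, ← mul_assoc e, he',
        ← mul_assoc]
    have h2 : e * d = 0 := by
      rw [← hcd]
      simp only [← mul_assoc, mul_sub, he', mul_one, sub_self, zero_mul]
    rw [← h1, ← mul_comm_of_mem_center hd, h2]
  have h₃ : e * a - a * e = e * a * (1 - e) - (1 - e) * a * e := by noncomm_ring
  rw [h₁, h₂, sub_self] at h₃
  exact sub_eq_zero.1 h₃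

/-- Fitting's lemma for left multiplication by `f` on a right Noetherian ring. -/
theorem IsRightNoetherianRing.exists_pow_mul_eq_zero (hN : IsRightNoetherianRing A) (f : A) :
    ∃ n ≠ 0, ∀ x, f ^ n * (f ^ n * x) = 0 → f ^ n * x = 0 := by
  have : IsNoetherian Aᵐᵒᵖ A := hN
  obtain ⟨n, hn⟩ := Filter.eventually_atTop.1
    (Module.End.eventually_disjoint_ker_pow_range_pow (Module.toModuleEnd Aᵐᵒᵖ A f))
  refine ⟨n + 1, n.succ_ne_zero, fun x hx => ?_⟩
  have key := hn (n + 1) n.le_succ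
  rw [← map_pow] at key
  exact (Submodule.disjoint_def.1 key) _ hx ⟨x, rfl⟩

/-- A right ideal `I` such that `d ∈ dI` for all central `d ∈ I` is generated by an idempotent. -/
theorem exists_idempotent_of_forall_central_mem (hN : IsRightNoetherianRing A)
    (hc : IsCentrallyEssential A) (I : Submodule Aᵐᵒᵖ A)
    (hI : ∀ d ∈ Subring.center A, d ∈ I → ∃ i ∈ I, d * i = d) :
    ∃ e ∈ I, e * e = e ∧ ∀ x ∈ I, e * x = x := by
  have hmul : ∀ x ∈ I, ∀ a, x * a ∈ I := fun x hx a => I.smul_mem (.op a) hx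
  have : IsNoetherian Aᵐᵒᵖ A := hN
  let S : Set A := {d | d ∈ Subring.center A ∧ d ∈ I}
  obtain ⟨s, hsS, hs⟩ := (Submodule.fg_span_iff_fg_span_finset_subset S).1
    (IsNoetherian.noetherian (Submodule.span Aᵐᵒᵖ S))
  have hfin : ∀ t : Finset A, (t : Set A) ⊆ S → ∃ i ∈ I, ∀ d ∈ t, d * i = d := by
    classical
    intro t
    induction t using Finset.induction_on with
    | empty => exact fun _ => ⟨0, I.zero_mem, by simp⟩
    | insert d t _ ih =>
      intro ht
      rw [Finset.coe_insert, Set.insert_subset_iff] at ht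
      obtain ⟨i, hi, hit⟩ := ih ht.2
      obtain ⟨j, hj, hjd⟩ := hI d ht.1.1 ht.1.2
      -- The new element `k` is chosen so that `1 - k = (1 - j) * (1 - i)`.
      refine ⟨j + i - j * i, I.sub_mem (I.add_mem hj hi) (hmul j hj i), ?_⟩
      intro d' hd'
      rcases Finset.mem_insert.1 hd' with rfl | hd'
      · rw [mul_sub, mul_add, ← mul_assoc, hjd]; abel
      · have h1 : d' * j * i = d' * j := by
          rw [← mul_comm_of_mem_center (ht.2 hd').1, mul_assoc, hit d' hd']
        rw [mul_sub, mul_add, ← mul_assoc, h1, hit d' hd']; abel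
  obtain ⟨i, hi, his⟩ := hfin s hsS
  obtain ⟨n, hn0, hn⟩ := hN.exists_pow_mul_eq_zero (1 - i)
  have hker : ∀ d ∈ S, (1 - i) ^ n * d = 0 := by
    intro d hd
    have hd' : d ∈ Submodule.span Aᵐᵒᵖ (s : Set A) := hs ▸ Submodule.subset_span hd
    obtain ⟨k, rfl⟩ := Nat.exists_eq_succ_of_ne_zero hn0
    rw [Nat.succ_eq_add_one, pow_succ, mul_assoc]
    suffices ∀ y ∈ Submodule.span Aᵐᵒᵖ (s : Set A), (1 - i) * y = 0 by rw [this d hd', mul_zero]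
    intro y hy
    induction hy using Submodule.span_induction with
    | mem x hx =>
      rw [mul_comm_of_mem_center (hsS hx).1, mul_sub, mul_one, his x hx, sub_self]
    | zero => rw [mul_zero]
    | add x y _ _ hx hy => rw [mul_add, hx, hy, add_zero]
    | smul a x _ hx =>
      change (1 - i) * (x * a.unop) = 0
      rw [← mul_assoc, hx, zero_mul]
  have hmem : ∀ k, 1 - (1 - i) ^ k ∈ I := by
    intro k
    induction k with
    | zero => simp
    | succ k ih =>
      have : 1 - (1 - i) ^ (k + 1) = (1 - (1 - i) ^ k) + i * (1 - i) ^ k := by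
        rw [pow_succ']; noncomm_ring
      rw [this]
      exact I.add_mem ih (hmul i hi _)
  -- If nonzero, `(1 - i) ^ n * x` has a nonzero central multiple in `I`; that multiple is killed by
  -- `(1 - i) ^ n` and lies in its image, against Fitting.
  have hzero : ∀ x ∈ I, (1 - i) ^ n * x = 0 := by
    intro x hx
    by_contra h
    obtain ⟨c, hcc, d, hd, -, hd0, hcd⟩ := hc _ h
    have hxI : (1 - i) ^ n * x ∈ I := by
      have : (1 - i) ^ n * x = x - (1 - (1 - i) ^ n) * x := by noncomm_ring
      rw [this]
      exact I.sub_mem hx (hmul _ (hmem n) x)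
    have := hker d ⟨hd, hcd ▸ hmul _ hxI c⟩
    rw [← hcd, mul_assoc] at this
    exact hd0 (by rw [← hcd, mul_assoc]; exact hn _ this)
  have hid : ∀ x ∈ I, (1 - (1 - i) ^ n) * x = x := fun x hx => by
    rw [sub_mul, one_mul, hzero x hx, sub_zero]
  exact ⟨_, hmem n, hid _ (hmem n), hid⟩

end CentrallyEssential

/-! ### Indecomposable rings -/

/-- A right distributive right Noetherian centrally essential ring without nontrivial idempotents;
right distributivity is expressed elementwise. -/
structure IsIndecomposableRDNCE (A : Type*) [Ring A] : Prop where
  distrib : ∀ a b : A, ∃ x y z : A, a * x = b * y ∧ b * (1 - x) = a * z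
  noeth : IsRightNoetherianRing A
  ce : IsCentrallyEssential A
  idem : ∀ e : A, e * e = e → e = 0 ∨ e = 1

namespace IsIndecomposableRDNCE

variable {A : Type*} [Ring A]

/-- For large `n` the right annihilator of `a ^ n` is generated by an idempotent: it is `0`, which
`x` excludes, or everything, so that `a ^ n = 0`. -/
theorem isNilpotent_of_mul_eq_zero (h : IsIndecomposableRDNCE A)
    {a x : A} (hax : a * x = 0) (hx : x ≠ 0) : IsNilpotent a := by
  obtain ⟨n, hn0, hn⟩ := h.noeth.exists_pow_mul_eq_zero a
  obtain ⟨e, heI, hee, he⟩ := exists_idempotent_of_forall_central_mem h.noeth h.ce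
    (LinearMap.ker (Module.toModuleEnd Aᵐᵒᵖ A (a ^ n))) (by
      intro d hd (hdI : a ^ n * d = 0)
      obtain ⟨t, y, z, h₁, h₂⟩ := h.distrib (a ^ n) d
      refine ⟨t, hn t ?_, ?_⟩
      · rw [h₁, ← mul_assoc, hdI, zero_mul]
      · have : a ^ n * z = 0 := hn z (by rw [← h₂, ← mul_assoc, hdI, zero_mul])
        rw [this, mul_sub, mul_one, sub_eq_zero] at h₂
        exact h₂.symm)
  rcases h.idem e hee with rfl | rfl
  · obtain ⟨k, rfl⟩ := Nat.exists_eq_succ_of_ne_zero hn0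
    refine absurd ?_ hx
    rw [← he x, zero_mul]
    change a ^ (k + 1) * x = 0
    rw [pow_succ, mul_assoc, hax, mul_zero]
  · exact ⟨n, by simpa using (show a ^ n * 1 = 0 from heI)⟩

theorem isNilpotent_of_mul_eq_zero' (h : IsIndecomposableRDNCE A)
    {a x : A} (hxa : x * a = 0) (hx : x ≠ 0) : IsNilpotent a := by
  obtain ⟨c, hcc, d, hd, -, hd0, hcd⟩ := h.ce x hx
  refine h.isNilpotent_of_mul_eq_zero (x := d) ?_ hd0
  rw [mul_comm_of_mem_center hd, ← hcd, mul_assoc, ← mul_comm_of_mem_center hcc, ← mul_assoc, hxa,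
    zero_mul]

theorem eq_zero_of_mul_eq_zero (h : IsIndecomposableRDNCE A)
    {a x : A} (ha : ¬ IsNilpotent a) (hax : a * x = 0) : x = 0 :=
  by_contra fun hx => ha (h.isNilpotent_of_mul_eq_zero hax hx)

theorem isNilpotent_mul_right (h : IsIndecomposableRDNCE A)
    [Nontrivial A] {a : A} (ha : IsNilpotent a) (r : A) :
    IsNilpotent (a * r) := by
  have hn := pow_pred_nilpotencyClass ha
  refine h.isNilpotent_of_mul_eq_zero' (x := a ^ (nilpotencyClass a - 1)) ?_ hn
  rw [← mul_assoc, ← pow_succ, Nat.sub_add_cancel (pos_nilpotencyClass_iff.2 ha),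
    pow_nilpotencyClass ha, zero_mul]

theorem isNilpotent_mul_left (h : IsIndecomposableRDNCE A)
    [Nontrivial A] {a : A} (ha : IsNilpotent a) (r : A) :
    IsNilpotent (r * a) := by
  have hn := pow_pred_nilpotencyClass ha
  refine h.isNilpotent_of_mul_eq_zero (x := a ^ (nilpotencyClass a - 1)) ?_ hn
  rw [mul_assoc, ← pow_succ', Nat.sub_add_cancel (pos_nilpotencyClass_iff.2 ha),
    pow_nilpotencyClass ha, mul_zero]

/-- The last nonzero power of `a * b` is killed by `a * b`, hence by `b`, since `a` is left
cancellable. -/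
theorem isNilpotent_of_mul (h : IsIndecomposableRDNCE A)
    [Nontrivial A] {a b : A} (ha : ¬ IsNilpotent a)
    (hab : IsNilpotent (a * b)) : IsNilpotent b := by
  have hn := pow_pred_nilpotencyClass hab
  refine h.isNilpotent_of_mul_eq_zero (x := (a * b) ^ (nilpotencyClass (a * b) - 1)) ?_ hn
  apply h.eq_zero_of_mul_eq_zero ha
  rw [← mul_assoc, ← pow_succ', Nat.sub_add_cancel (pos_nilpotencyClass_iff.2 hab),
    pow_nilpotencyClass hab]

/-- If there is no nonzero central nilpotent element, then `A` is a commutative domain. -/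
theorem comm_domain_of_reduced_center (h : IsIndecomposableRDNCE A) [Nontrivial A]
    (hC : ∀ d ∈ Subring.center A, IsNilpotent d → d = 0) :
    (∀ x y : A, x * y = y * x) ∧ ∀ x y : A, x * y = 0 → x = 0 ∨ y = 0 := by
  have hreg : ∀ a : A, a ≠ 0 → ¬ IsNilpotent a := by
    intro a ha hna
    obtain ⟨c, -, d, hd, -, hd0, hcd⟩ := h.ce a ha
    exact hd0 (hC d hd (hcd ▸ h.isNilpotent_mul_right hna c))
  refine ⟨fun a b => ?_, fun x y hxy => ?_⟩
  · by_cases ha : a = 0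
    · simp [ha]
    by_cases hb : b = 0
    · simp [hb]
    obtain ⟨c, hc, d, hd, hc0, -, hcd⟩ := h.ce a ha
    obtain ⟨c', hc', d', hd', hc0', -, hcd'⟩ := h.ce b hb
    -- As `a * c` and `b * c'` are central, both products become `d * d'`.
    have h₁ : c * (c' * (a * b - b * a)) = 0 := by
      have e1 : c * (c' * (a * b)) = d * d' := by
        rw [← mul_comm_of_mem_center hc' (a * b), mul_assoc a, hcd', mul_comm_of_mem_center hd' a,
          ← mul_comm_of_mem_center hc (d' * a), mul_assoc, hcd, mul_comm_of_mem_center hd d']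
      have e2 : c * (c' * (b * a)) = d * d' := by
        rw [← hcd', ← mul_assoc c' b, ← mul_comm_of_mem_center hc' b, hcd', ← mul_assoc,
          ← mul_comm_of_mem_center hc d', mul_assoc, ← mul_comm_of_mem_center hc a, hcd,
          mul_comm_of_mem_center hd]
      rw [mul_sub, mul_sub, e1, e2, sub_self]
    exact sub_eq_zero.1 (h.eq_zero_of_mul_eq_zero (hreg _ hc0')
      (h.eq_zero_of_mul_eq_zero (hreg _ hc0) h₁))
  · by_cases hx : x = 0
    · exact .inl hx
    · exact .inr (h.eq_zero_of_mul_eq_zero (hreg x hx) hxy)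

theorem exists_eq_mul_of_isNilpotent (h : IsIndecomposableRDNCE A)
    [Nontrivial A] {n a : A} (hn : IsNilpotent n)
    (ha : ¬ IsNilpotent a) : ∃ m, n = a * m := by
  obtain ⟨x, y, z, h₁, h₂⟩ := h.distrib n a
  have hx : IsNilpotent (1 - x) :=
    h.isNilpotent_of_mul ha (h₂ ▸ h.isNilpotent_mul_right hn z)
  have hu : IsUnit x := by simpa using hx.isUnit_one_sub
  obtain ⟨v, hv⟩ := hu.exists_right_inv
  exact ⟨y * v, by rw [← mul_assoc, ← h₁, mul_assoc, hv, mul_one]⟩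

/-- Take `d ∈ E` nonzero with `dA` maximal and write `d = a * d'`. Maximality gives `d' = d * b`, so
`d' * (1 - a * b) = 0`; thus `1 - a * b` is nilpotent and `a * b` a unit. -/
theorem isUnit_of_central_chain (h : IsIndecomposableRDNCE A)
    {a : A} (ha : ¬ IsNilpotent a) {E : Set A}
    (hE : ∀ d ∈ E, d ∈ Subring.center A) (hne : ∃ d ∈ E, d ≠ 0)
    (hdiv : ∀ d ∈ E, ∃ d' ∈ E, d = a * d') : IsUnit a := by
  have : IsNoetherian Aᵐᵒᵖ A := h.noeth
  obtain ⟨d₀, hd₀, hd₀'⟩ := hne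
  let F : Set (Submodule Aᵐᵒᵖ A) := {X | ∃ d ∈ E, d ≠ 0 ∧ X = Submodule.span _ {d}}
  obtain ⟨X, ⟨d, hdE, hd0, rfl⟩, hmax⟩ :=
    set_has_maximal_iff_noetherian.2 this F ⟨_, d₀, hd₀, hd₀', rfl⟩
  obtain ⟨d', hd'E, hd'⟩ := hdiv d hdE
  have hd'0 : d' ≠ 0 := by rintro rfl; exact hd0 (by rw [hd', mul_zero])
  have hle : Submodule.span Aᵐᵒᵖ {d} ≤ Submodule.span Aᵐᵒᵖ {d'} := by
    rw [Submodule.span_singleton_le_iff_mem, Submodule.mem_span_singleton]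
    refine ⟨.op a, ?_⟩
    change d' * a = d
    rw [hd', mul_comm_of_mem_center (hE d' hd'E)]
  have hge : d' ∈ Submodule.span Aᵐᵒᵖ {d} := by
    by_contra hcon
    refine hmax _ ⟨d', hd'E, hd'0, rfl⟩ (lt_of_le_of_ne hle ?_)
    intro heq
    exact hcon (heq ▸ Submodule.mem_span_singleton_self d')
  obtain ⟨b, hb⟩ := Submodule.mem_span_singleton.1 hge
  have hb' : d * b.unop = d' := hb
  have hnil : IsNilpotent (1 - a * b.unop) := by
    refine h.isNilpotent_of_mul_eq_zero' (x := d') ?_ hd'0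
    rw [mul_sub, mul_one, ← mul_assoc, ← mul_comm_of_mem_center (hE d' hd'E), ← hd', hb', sub_self]
  have hu : IsUnit (a * b.unop) := by simpa using hnil.isUnit_one_sub
  obtain ⟨w, hw⟩ := hu.exists_right_inv
  rw [mul_assoc] at hw
  refine isUnit_iff_exists.2 ⟨_, hw, ?_⟩
  refine sub_eq_zero.1 (h.eq_zero_of_mul_eq_zero ha ?_)
  rw [mul_sub, ← mul_assoc, hw, one_mul, mul_one, sub_self]

/-- There is a nonzero central element annihilated by all central nilpotent elements. -/
theorem exists_central_annihilator (h : IsIndecomposableRDNCE A)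
    [Nontrivial A] : ∃ d ∈ Subring.center A, d ≠ 0 ∧
    ∀ k ∈ Subring.center A, IsNilpotent k → d * k = 0 := by
  have : IsNoetherian Aᵐᵒᵖ A := h.noeth
  let ann : A → Submodule Aᵐᵒᵖ A := fun d => LinearMap.ker (Module.toModuleEnd Aᵐᵒᵖ A d)
  let F : Set (Submodule Aᵐᵒᵖ A) := {X | ∃ d ∈ Subring.center A, d ≠ 0 ∧ X = ann d}
  obtain ⟨X, ⟨d, hd, hd0, rfl⟩, hmax⟩ :=
    set_has_maximal_iff_noetherian.2 this F ⟨_, 1, one_mem _, one_ne_zero, rfl⟩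
  refine ⟨d, hd, hd0, fun k hk hkn => ?_⟩
  by_contra hdk
  classical
  have hex : ∃ j, d * k ^ (j + 1) = 0 := by
    obtain ⟨j, hj⟩ := hkn
    exact ⟨j, by rw [pow_succ, hj, zero_mul, mul_zero]⟩
  let j := Nat.find hex
  have hj : d * k ^ (j + 1) = 0 := Nat.find_spec hex
  have hj0 : d * k ^ j ≠ 0 := by
    rcases Nat.eq_zero_or_eq_succ_pred j with h0 | h0
    · rwa [h0, pow_zero, mul_one]
    · have := Nat.find_min hex (m := j - 1) (by change j - 1 < j; omega)
      rwa [show j - 1 + 1 = j by omega] at this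
  -- `d * k ^ j` is the last nonzero term of its sequence, so `k` annihilates it but not `d`.
  have hlt : ann d < ann (d * k ^ j) := by
    refine lt_of_le_of_ne ?_ ?_
    · intro x (hx : d * x = 0)
      change d * k ^ j * x = 0
      rw [← mul_comm_of_mem_center (mul_mem hd (pow_mem hk j)), ← mul_assoc,
        mul_comm_of_mem_center hd, hx, zero_mul]
    · intro heq
      have : k ∈ ann (d * k ^ j) := by
        change d * k ^ j * k = 0
        rw [mul_assoc, ← pow_succ, hj]
      rw [← heq] at this
      exact hdk this
  exact hmax _ ⟨_, mul_mem hd (pow_mem hk j), hj0, rfl⟩ hlt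

/-- If some nonzero central element is nilpotent, then `A` is a local ring with nil radical. -/
theorem isNilpotent_or_isUnit (h : IsIndecomposableRDNCE A)
    [Nontrivial A] {k₀ : A} (hk₀ : k₀ ∈ Subring.center A)
    (hk₀n : IsNilpotent k₀) (hk₀0 : k₀ ≠ 0) (a : A) : IsNilpotent a ∨ IsUnit a := by
  have hcentral : ∀ c ∈ Subring.center A, ¬ IsNilpotent c → IsUnit c := by
    intro c hc hcn
    refine h.isUnit_of_central_chain hcn (E := {d | d ∈ Subring.center A ∧ IsNilpotent d})
      (fun d hd => hd.1) ⟨k₀, ⟨hk₀, hk₀n⟩, hk₀0⟩ ?_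
    rintro d ⟨hd, hdn⟩
    obtain ⟨m, rfl⟩ := h.exists_eq_mul_of_isNilpotent hdn hcn
    refine ⟨m, ⟨Subring.mem_center_iff.2 fun b => ?_, h.isNilpotent_of_mul hcn hdn⟩, rfl⟩
    refine sub_eq_zero.1 (h.eq_zero_of_mul_eq_zero hcn ?_)
    rw [mul_sub, ← mul_assoc, ← mul_comm_of_mem_center hc, mul_assoc,
      mul_comm_of_mem_center hd, mul_assoc, sub_self]
  refine or_iff_not_imp_left.2 fun ha => ?_
  let D : Set A := {x | ∀ k ∈ Subring.center A, IsNilpotent k → x * k = 0}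
  -- For `d ≠ 0` take `c` central with `d * c` central and nonzero. By definition of `D`, `c` is not
  -- nilpotent, so it can be cancelled.
  have hDC : ∀ d ∈ D, d ∈ Subring.center A := by
    intro d hd
    by_cases hd0 : d = 0
    · rw [hd0]; exact zero_mem _
    obtain ⟨c, hc, d', hd', -, hd'0, hcd⟩ := h.ce d hd0
    have hcn : ¬ IsNilpotent c := fun hcn => hd'0 (by rw [← hcd, hd c hc hcn])
    obtain ⟨v, hv⟩ := (hcentral c hc hcn).exists_right_inv
    rw [Subring.mem_center_iff]
    intro b
    refine sub_eq_zero.1 (h.eq_zero_of_mul_eq_zero hcn ?_)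
    rw [mul_sub, ← mul_comm_of_mem_center hc, ← mul_comm_of_mem_center hc, mul_assoc, hcd,
      mul_assoc, mul_comm_of_mem_center hc b, ← mul_assoc d, hcd, mul_comm_of_mem_center hd',
      sub_self]
  obtain ⟨d, hd, hd0, hdD⟩ := h.exists_central_annihilator
  refine h.isUnit_of_central_chain ha (E := D) hDC ⟨d, hdD, hd0⟩ ?_
  intro x hx
  have hxn : IsNilpotent x := h.isNilpotent_of_mul_eq_zero (hx k₀ hk₀ hk₀n) hk₀0
  obtain ⟨m, rfl⟩ := h.exists_eq_mul_of_isNilpotent hxn ha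
  refine ⟨m, fun k hk hkn => h.eq_zero_of_mul_eq_zero ha ?_, rfl⟩
  rw [← mul_assoc, hx k hk hkn]

end IsIndecomposableRDNCE

/-! ### Local rings with nil radical -/

section NilLocal

theorem exists_pow_mul_unit {A : Type*} [Ring A] {p : A} (hnu : ∀ a : A, IsNilpotent a ∨ IsUnit a)
    (hp : IsNilpotent p) (hpdvd : ∀ a : A, IsNilpotent a → p ∣ a) {a : A} (ha : a ≠ 0) :
    ∃ k u, IsUnit u ∧ a = p ^ k * u := by
  by_contra! hcon
  have key : ∀ n, p ^ n ∣ a := by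
    intro n
    induction n with
    | zero => simp
    | succ n ih =>
      obtain ⟨y, hy⟩ := ih
      rcases hnu y with hyn | hyu
      · obtain ⟨z, rfl⟩ := hpdvd y hyn
        exact ⟨z, by rw [hy, pow_succ, mul_assoc]⟩
      · exact absurd hy (hcon n y hyu)
  obtain ⟨n, hn⟩ := hp
  have := key n
  rw [hn, zero_dvd_iff] at this
  exact ha this

variable {A : Type*} [Ring A]

theorem isUniserialRing_and_isTwoSidedArtinianRing_of_generator {p : A}
    (hnu : ∀ a : A, IsNilpotent a ∨ IsUnit a) (hp : IsNilpotent p)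
    (hright : ∀ a : A, IsNilpotent a → ∃ y, a = p * y)
    (hleft : ∀ a : A, IsNilpotent a → ∃ y, a = y * p) :
    IsUniserialRing A ∧ IsTwoSidedArtinianRing A := by
  have hr : ∀ a : A, a ≠ 0 → ∃ k, ∃ r : Aᵐᵒᵖ, IsUnit r ∧ a = r • p ^ k := by
    intro a ha
    obtain ⟨k, u, hu, h⟩ := exists_pow_mul_unit hnu hp hright ha
    exact ⟨k, .op u, hu.op, h⟩
  have hl : ∀ a : A, a ≠ 0 → ∃ k, ∃ r : A, IsUnit r ∧ a = r • p ^ k := by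
    intro a ha
    have hnil : ∀ b : Aᵐᵒᵖ, IsNilpotent b ↔ IsNilpotent b.unop := fun b =>
      exists_congr fun n => by rw [← MulOpposite.unop_pow, MulOpposite.unop_eq_zero_iff]
    obtain ⟨k, u, hu, h⟩ := exists_pow_mul_unit (A := Aᵐᵒᵖ) (p := .op p) (a := .op a)
      (fun b => by
        rw [hnil, ← isUnit_unop]
        exact hnu b.unop)
      ((hnil _).2 hp)
      (fun b hb => by
        obtain ⟨y, hy⟩ := hleft b.unop ((hnil b).1 hb)
        exact ⟨.op y, MulOpposite.unop_injective hy⟩)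
      (by simpa using ha)
    exact ⟨k, u.unop, isUnit_unop.2 hu, MulOpposite.op_injective (by simpa using h)⟩
  obtain ⟨n, hn⟩ := hp
  have h0 : ∀ k, n ≤ k → p ^ k = 0 := fun k hk => pow_eq_zero_of_le hk hn
  refine ⟨⟨.of_chain hr fun k => ?_, .of_chain hl fun k => ?_⟩, .of_chain hr h0, .of_chain hl h0⟩
  · exact Submodule.mem_span_singleton.2 ⟨.op p, (pow_succ p k).symm⟩
  · exact Submodule.mem_span_singleton.2 ⟨p, (pow_succ' p k).symm⟩

/-- A centrally essential local ring whose nil radical is `pA` has nil radical `Ap`. -/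
theorem IsCentrallyEssential.exists_eq_mul_generator (hc : IsCentrallyEssential A) {p : A}
    (hnu : ∀ a : A, IsNilpotent a ∨ IsUnit a) (hp : IsNilpotent p)
    (hright : ∀ a : A, IsNilpotent a → ∃ y, a = p * y)
    (hmul : ∀ a, IsNilpotent (a * p)) (a : A) : ∃ b, p * a = b * p := by
  by_cases hp0 : p = 0
  · exact ⟨0, by simp [hp0]⟩
  have : Nontrivial A := ⟨p, 0, hp0⟩
  obtain ⟨n, hn0, hn1⟩ : ∃ n, p ^ (n + 1) ≠ 0 ∧ p ^ (n + 2) = 0 := by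
    have h1 : 1 < nilpotencyClass p := by
      have h₁ := pos_nilpotencyClass_iff.2 hp
      have h₂ : nilpotencyClass p ≠ 1 := fun h => hp0 (nilpotencyClass_eq_one.1 h)
      omega
    refine ⟨nilpotencyClass p - 2, ?_, ?_⟩
    · rw [show nilpotencyClass p - 2 + 1 = nilpotencyClass p - 1 by omega]
      exact pow_pred_nilpotencyClass hp
    · rw [Nat.sub_add_cancel h1]
      exact pow_nilpotencyClass hp
  -- A central `c` with `p ^ (n + 1) * c ≠ 0` cannot lie in `pA`, so it is a unit: the last nonzero
  -- power of `p` is central.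
  have hcomm : ∀ b, b * p ^ (n + 1) = p ^ (n + 1) * b := by
    obtain ⟨c, hcc, z, hz, -, hz0, hcz⟩ := hc _ hn0
    rcases hnu c with hcn | hcu
    · obtain ⟨y, rfl⟩ := hright c hcn
      rw [← mul_assoc, ← pow_succ, hn1, zero_mul] at hcz
      exact absurd hcz.symm hz0
    · intro b
      refine hcu.mul_right_cancel ?_
      rw [mul_assoc, hcz, mul_comm_of_mem_center hz, mul_assoc, mul_comm_of_mem_center hcc b,
        ← mul_assoc, hcz]
  have hpow : ∀ k b, ∃ b', b * p ^ k = p ^ k * b' := by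
    intro k
    induction k with
    | zero => exact fun b => ⟨b, by simp⟩
    | succ k ih =>
      intro b
      obtain ⟨b₁, h₁⟩ := ih b
      obtain ⟨b₂, h₂⟩ := hright _ (hmul b₁)
      exact ⟨b₂, by rw [pow_succ, ← mul_assoc, h₁, mul_assoc, h₂, mul_assoc]⟩
  -- Centrality of `p ^ (n + 1)` gives `p ^ n * (p * b - b' * p) = 0`; an element `p ^ k * u` killed
  -- by `p ^ n` has `k ≥ 2`.
  have hmod : ∀ b, ∃ b' y, p * b = b' * p + p ^ 2 * y := by
    intro b
    obtain ⟨b', hb'⟩ := hpow n b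
    have h₀ : p ^ n * (p * b - b' * p) = 0 := by
      rw [mul_sub, ← mul_assoc, ← pow_succ, ← hcomm, ← mul_assoc, ← hb', mul_assoc, ← pow_succ,
        sub_self]
    by_cases hw : p * b - b' * p = 0
    · exact ⟨b', 0, by rw [mul_zero, add_zero, ← sub_eq_zero, hw]⟩
    obtain ⟨k, u, hu, hk⟩ := exists_pow_mul_unit hnu hp hright hw
    have hk2 : 2 ≤ k := by
      by_contra hlt
      rw [hk, ← mul_assoc, ← pow_add, hu.mul_left_eq_zero] at h₀
      exact hn0 (pow_eq_zero_of_le (by omega) h₀)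
    refine ⟨b', p ^ (k - 2) * u, ?_⟩
    rw [← mul_assoc, ← pow_add, Nat.add_sub_cancel' hk2, ← hk]
    abel
  -- Successive approximation: `hmod` is applied to the error term until the power of `p` vanishes.
  have happrox : ∀ k, ∃ b y, p * a = b * p + p ^ (k + 1) * y := by
    intro k
    induction k with
    | zero => exact ⟨0, a, by simp⟩
    | succ k ih =>
      obtain ⟨b, y, h⟩ := ih
      obtain ⟨b', y', h'⟩ := hmod y
      refine ⟨b + p ^ k * b', y', ?_⟩
      rw [h, pow_succ, mul_assoc (p ^ k), h', mul_add, add_mul, ← mul_assoc, ← mul_assoc, ← pow_add,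
        add_assoc]
  obtain ⟨b, y, h⟩ := happrox (n + 1)
  exact ⟨b, by rw [h, hn1, zero_mul, add_zero]⟩

theorem IsIndecomposableRDNCE.isUniserialRing_and_isTwoSidedArtinianRing [Nontrivial A]
    (h : IsIndecomposableRDNCE A) (hnu : ∀ a : A, IsNilpotent a ∨ IsUnit a) :
    IsUniserialRing A ∧ IsTwoSidedArtinianRing A := by
  have : IsNoetherian Aᵐᵒᵖ A := h.noeth
  have hchain : ∀ a b : A, (∃ y, a = b * y) ∨ ∃ z, b = a * z := by
    intro a b
    obtain ⟨x, y, z, h₁, h₂⟩ := h.distrib a b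
    have aux : ∀ {c d x y : A}, IsUnit x → c * x = d * y → ∃ y, c = d * y := by
      intro c d x y hx hcd
      obtain ⟨v, hv⟩ := hx.exists_right_inv
      exact ⟨y * v, by rw [← mul_assoc, ← hcd, mul_assoc, hv, mul_one]⟩
    rcases hnu x with hx | hx
    · exact .inr (aux hx.isUnit_one_sub h₂)
    · exact .inl (aux hx h₁)
  let F : Set (Submodule Aᵐᵒᵖ A) := {X | ∃ a : A, IsNilpotent a ∧ X = Submodule.span _ {a}}
  obtain ⟨X, ⟨p, hp, rfl⟩, hmax⟩ :=
    set_has_maximal_iff_noetherian.2 this F ⟨_, 0, .zero, rfl⟩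
  have hright : ∀ a : A, IsNilpotent a → ∃ y, a = p * y := by
    intro a ha
    rcases hchain a p with h' | ⟨z, hz⟩
    · exact h'
    by_contra hcon
    refine hmax _ ⟨a, ha, rfl⟩ (lt_of_le_of_ne ?_ ?_)
    · exact (Submodule.span_singleton_le_iff_mem _ _).2
        (Submodule.mem_span_singleton.2 ⟨.op z, hz.symm⟩)
    · intro heq
      obtain ⟨y, hy⟩ := Submodule.mem_span_singleton.1
        (heq ▸ Submodule.mem_span_singleton_self (R := Aᵐᵒᵖ) a)
      exact hcon ⟨y.unop, hy.symm⟩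
  refine isUniserialRing_and_isTwoSidedArtinianRing_of_generator hnu hp hright fun a ha => ?_
  obtain ⟨y, rfl⟩ := hright a ha
  exact h.ce.exists_eq_mul_generator hnu hp hright (h.isNilpotent_mul_left hp) y

end NilLocal

/-! ### Dedekind domains -/

section Dedekind

variable {A : Type*} [CommRing A]

theorem dimensionLEOne_of_distrib [IsDomain A] [IsNoetherianRing A]
    (hd : ∀ a b : A, ∃ x y z : A, a * x = b * y ∧ b * (1 - x) = a * z) :
    Ring.DimensionLEOne A where
  maximalOfPrime := by
    intro P hP0 hP
    refine Ideal.isMaximal_iff.2 ⟨(Ideal.ne_top_iff_one P).1 hP.ne_top, fun J a hPJ haP haJ => ?_⟩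
    -- Since `a ∉ P`, the criterion puts both `1 - x` and `y` in `P`; Nakayama's lemma for `P = J *
    -- P` then yields `1 ∈ J`.
    have hle : P ≤ J * P := by
      intro p hp
      obtain ⟨x, y, z, h₁, h₂⟩ := hd p a
      have hx : 1 - x ∈ P :=
        (hP.mem_or_mem (h₂ ▸ P.mul_mem_right z hp : a * (1 - x) ∈ P)).resolve_left haP
      have hy : y ∈ P := (hP.mem_or_mem (h₁ ▸ P.mul_mem_right x hp : a * y ∈ P)).resolve_left haP
      have : p = p * (1 - x) + a * y := by rw [← h₁]; ring
      rw [this]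
      exact Ideal.add_mem _ (Ideal.mul_mem_mul (hPJ hp) hx) (Ideal.mul_mem_mul haJ hy)
    obtain ⟨r, hr, hrP⟩ := Submodule.exists_sub_one_mem_and_smul_eq_zero_of_fg_of_le_smul J P
      (IsNoetherian.noetherian P) hle
    obtain ⟨p, hp, hp0⟩ := Submodule.exists_mem_ne_zero_of_ne_bot hP0
    have hr0 : r = 0 := (mul_eq_zero.1 (hrP p hp)).resolve_right hp0
    rw [hr0, zero_sub] at hr
    exact neg_mem_iff.1 hr

theorem isIntegrallyClosed_of_distrib [IsDomain A]
    (hd : ∀ a b : A, ∃ x y z : A, a * x = b * y ∧ b * (1 - x) = a * z) :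
    IsIntegrallyClosed A := by
  refine (isIntegrallyClosed_iff (FractionRing A)).2 fun {t} ht => ?_
  obtain ⟨u, v, hv, rfl⟩ := IsFractionRing.div_surjective (A := A) t
  obtain ⟨x, y, z, h₁, h₂⟩ := hd u v
  have hv0 : algebraMap A (FractionRing A) v ≠ 0 :=
    IsFractionRing.to_map_ne_zero_of_mem_nonZeroDivisors hv
  set φ := algebraMap A (FractionRing A)
  set t := φ u / φ v with htdef
  have hx : t * φ x = φ y := by
    rw [htdef, div_mul_eq_mul_div, ← map_mul, h₁, map_mul, mul_div_cancel_left₀ _ hv0]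
  have hz : t * φ z = φ (1 - x) := by
    rw [htdef, div_mul_eq_mul_div, ← map_mul, ← h₂, map_mul, mul_div_cancel_left₀ _ hv0]
  obtain ⟨f, hf, hft⟩ := ht
  -- With `n + 1` the degree of the integral equation, `t (1 - x)^n = t^(n+1) z^n`. Substituting the
  -- equation leaves terms `t^i z^n = (1 - x)^i z^(n-i)`, which lie in `A`. As `t x` does too and
  -- `x`, `(1 - x)^n` are coprime, `t ∈ A`.
  have hpow : ∃ n w, t * φ (1 - x) ^ n = φ w := by
    rw [Polynomial.eval₂_eq_sum_range] at hft
    rcases Nat.eq_zero_or_eq_succ_pred f.natDegree with h0 | h0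
    · rw [Polynomial.Monic.natDegree_eq_zero hf |>.1 h0] at hft
      simp at hft
    set n := f.natDegree.pred
    rw [h0, Finset.sum_range_succ, ← Nat.succ_eq_add_one, ← h0, hf.coeff_natDegree,
      map_one, one_mul, h0] at hft
    refine ⟨n, -∑ i ∈ Finset.range (n + 1), f.coeff i * (1 - x) ^ i * z ^ (n - i), ?_⟩
    rw [map_neg, map_sum, ← sub_eq_zero, sub_neg_eq_add]
    have : t * φ (1 - x) ^ n = t ^ (n + 1) * φ z ^ n := by rw [← hz]; ring
    rw [this, add_comm]
    calc _ = (∑ i ∈ Finset.range (n + 1), φ (f.coeff i) * t ^ i + t ^ (n + 1)) * φ z ^ n := by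
          rw [add_mul, Finset.sum_mul]
          congr 1
          refine Finset.sum_congr rfl fun i hi => ?_
          have hi' : i ≤ n := Nat.lt_succ_iff.1 (Finset.mem_range.1 hi)
          rw [map_mul, map_mul, map_pow, map_pow, ← hz, mul_pow, ← Nat.add_sub_cancel' hi',
            Nat.add_sub_cancel_left, pow_add]
          ring
      _ = 0 := by
          convert zero_mul _
  obtain ⟨n, w, hw⟩ := hpow
  obtain ⟨α, β, hαβ⟩ : IsCoprime x ((1 - x) ^ n) :=
    IsCoprime.pow_right ⟨1, 1, by ring⟩
  refine ⟨α * y + β * w, ?_⟩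
  have h1 : φ α * φ x + φ β * φ (1 - x) ^ n = 1 := by
    rw [← map_pow, ← map_mul, ← map_mul, ← map_add, hαβ, map_one]
  change φ _ = t
  rw [map_add, map_mul, map_mul, ← hx, ← hw]
  linear_combination t * h1

theorem isDedekindDomain_of_distrib [IsDomain A] [IsNoetherianRing A]
    (hd : ∀ a b : A, ∃ x y z : A, a * x = b * y ∧ b * (1 - x) = a * z) :
    IsDedekindDomain A :=
  have := dimensionLEOne_of_distrib hd
  have := isIntegrallyClosed_of_distrib hd
  { }

theorem IsDedekindDomain.exists_mul_eq_mul [IsDedekindDomain A] (a b : A) :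
    ∃ x y z : A, a * x = b * y ∧ b * (1 - x) = a * z := by
  by_cases ha : a = 0
  · exact ⟨1, 0, 0, by simp [ha], by simp⟩
  have hI0 : Ideal.span {a} ⊔ Ideal.span {b} ≠ ⊥ := by
    intro h
    exact ha (Ideal.span_singleton_eq_bot.1 (eq_bot_iff.2 (h ▸ le_sup_left)))
  obtain ⟨I, hI⟩ : ∃ I, I = Ideal.span {a} ⊔ Ideal.span {b} := ⟨_, rfl⟩
  rw [← hI] at hI0
  obtain ⟨K, hK⟩ : I ∣ Ideal.span {a} := Ideal.dvd_iff_le.2 (hI ▸ le_sup_left)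
  obtain ⟨L, hL⟩ : I ∣ Ideal.span {b} := Ideal.dvd_iff_le.2 (hI ▸ le_sup_right)
  -- Cancelling the nonzero ideal `I = (a) + (b)` makes the cofactors comaximal; `x` is the `L`-part
  -- of `1`.
  have hKL : K ⊔ L = ⊤ := by
    have : I * (K ⊔ L) = I * ⊤ := by rw [Ideal.mul_sup, ← hK, ← hL, ← hI, Ideal.mul_top]
    exact mul_left_cancel₀ (M₀ := Ideal A) hI0 this
  obtain ⟨w, hw, x, hx, hwx⟩ := Submodule.mem_sup.1 ((Ideal.eq_top_iff_one _).1 hKL)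
  have h₁ : a * x ∈ Ideal.span {b} := by
    have : a * x ∈ Ideal.span {a} * L := Ideal.mul_mem_mul (Ideal.mem_span_singleton_self a) hx
    rw [hK, mul_right_comm, ← hL] at this
    exact Ideal.mul_le_left this
  have h₂ : b * w ∈ Ideal.span {a} := by
    have : b * w ∈ Ideal.span {b} * K := Ideal.mul_mem_mul (Ideal.mem_span_singleton_self b) hw
    rw [hL, mul_right_comm, ← hK] at this
    exact Ideal.mul_le_left this
  obtain ⟨y, hy⟩ := Ideal.mem_span_singleton.1 h₁
  obtain ⟨z, hz⟩ := Ideal.mem_span_singleton.1 h₂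
  exact ⟨x, y, z, hy, by rw [← hwx, add_sub_cancel_right, hz]⟩

end Dedekind

/-! ### Comparison of one-sided chain conditions -/

section Opposite

variable {A : Type*} [Ring A]

/-- `A` and `Aᵐᵒᵖ` are isomorphic as right `A`-modules. -/
def opSelfLinearEquiv (A : Type*) [Ring A] : A ≃ₗ[Aᵐᵒᵖ] Aᵐᵒᵖ where
  __ := MulOpposite.opAddEquiv
  map_smul' _ _ := rfl

theorem isRightNoetherianRing_iff : IsRightNoetherianRing A ↔ IsNoetherianRing Aᵐᵒᵖ :=
  (LinearEquiv.isNoetherian_iff (opSelfLinearEquiv A))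

theorem isNoetherianRing_op_of_isArtinian (h : IsArtinian Aᵐᵒᵖ A) : IsNoetherianRing Aᵐᵒᵖ := by
  have : IsArtinianRing Aᵐᵒᵖ := (LinearEquiv.isArtinian_iff (opSelfLinearEquiv A)).1 h
  infer_instance

end Opposite

theorem isCommutativeDedekindDomain_of_comm_domain {A : Type*} [Ring A] [Nontrivial A]
    (hcomm : ∀ x y : A, x * y = y * x) (hdom : ∀ x y : A, x * y = 0 → x = 0 ∨ y = 0)
    (hN : IsRightNoetherianRing A)
    (hd : ∀ a b : A, ∃ x y z : A, a * x = b * y ∧ b * (1 - x) = a * z) :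
    IsCommutativeDedekindDomain A := by
  refine ⟨hcomm, ?_⟩
  let _ : CommRing A := { (inferInstance : Ring A) with mul_comm := hcomm }
  have : NoZeroDivisors A := ⟨fun {x y} h => hdom x y h⟩
  have : IsDomain A := NoZeroDivisors.to_isDomain A
  have := isRightNoetherianRing_iff.1 hN
  have : IsNoetherianRing A := isNoetherianRing_of_ringEquiv Aᵐᵒᵖ (RingEquiv.toOpposite A).symm
  exact isDedekindDomain_of_distrib hd

theorem IsCommutativeDedekindDomain.properties {A : Type*} [Ring A]
    (h : IsCommutativeDedekindDomain A) :
    IsDistributiveRing A ∧ IsNoetherianRing Aᵐᵒᵖ ∧ IsNoetherianRing A ∧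
      IsCentrallyEssential A := by
  obtain ⟨hcomm, hD⟩ := h
  let _ : CommRing A := { (inferInstance : Ring A) with mul_comm := hcomm }
  have : IsDedekindDomain A := hD
  have hN : IsNoetherianRing A := inferInstance
  refine ⟨⟨isRightDistributiveRing_iff.2 IsDedekindDomain.exists_mul_eq_mul,
    isDistributiveModule_self_iff.2 fun a b => ?_⟩,
    isNoetherianRing_of_ringEquiv A (RingEquiv.toOpposite A), hN, fun a ha => ?_⟩
  · obtain ⟨x, y, z, h₁, h₂⟩ := IsDedekindDomain.exists_mul_eq_mul a b
    exact ⟨x, y, z, by rw [mul_comm x, mul_comm y, h₁], by rw [mul_comm _ b, mul_comm z, h₂]⟩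
  · exact ⟨1, one_mem _, a, Subring.mem_center_iff.2 fun b => hcomm b a, one_ne_zero, ha, mul_one a⟩

/-! ### Products -/

section Products

theorem map_mem_center {A B : Type*} [Ring A] [Ring B] {φ : A →+* B}
    (hφ : Function.Surjective φ) {c : A} (hc : c ∈ Subring.center A) :
    φ c ∈ Subring.center B := by
  rw [Subring.mem_center_iff]
  intro b
  obtain ⟨a, rfl⟩ := hφ b
  rw [← map_mul, ← map_mul, mul_comm_of_mem_center hc]

theorem IsRightDistributiveRing.of_surjective {A B : Type*} [Ring A] [Ring B]
    (h : IsRightDistributiveRing A) {φ : A →+* B} (hφ : Function.Surjective φ) :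
    IsRightDistributiveRing B := by
  rw [isRightDistributiveRing_iff] at h ⊢
  intro a b
  obtain ⟨a, rfl⟩ := hφ a
  obtain ⟨b, rfl⟩ := hφ b
  obtain ⟨x, y, z, h₁, h₂⟩ := h a b
  exact ⟨φ x, φ y, φ z, by rw [← map_mul, h₁, map_mul],
    by rw [← map_one φ, ← map_sub, ← map_mul, h₂, map_mul]⟩

theorem IsRightNoetherianRing.of_surjective {A B : Type*} [Ring A] [Ring B]
    (h : IsRightNoetherianRing A) {φ : A →+* B} (hφ : Function.Surjective φ) :
    IsRightNoetherianRing B := by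
  rw [isRightNoetherianRing_iff] at h ⊢
  refine isNoetherianRing_of_surjective Aᵐᵒᵖ Bᵐᵒᵖ (RingHom.op φ) fun b => ?_
  obtain ⟨a, ha⟩ := hφ b.unop
  exact ⟨.op a, MulOpposite.unop_injective ha⟩

variable {ι : Type*} {A : Type*} [Ring A] {B : ι → Type*} [∀ i, Ring (B i)]

theorem eval_comp_surjective (e : A ≃+* ∀ i, B i) (i : ι) :
    Function.Surjective ((Pi.evalRingHom B i).comp (e : A →+* ∀ i, B i)) :=
  (Function.surjective_eval i).comp e.surjective

theorem IsCentrallyEssential.of_ringEquiv_pi (h : IsCentrallyEssential A) (e : A ≃+* ∀ i, B i)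
    (i : ι) : IsCentrallyEssential (B i) := by
  classical
  intro b hb
  obtain ⟨c, hc, d, hd, -, hd0, hcd⟩ := h (e.symm (Pi.single i b)) (by simpa using hb)
  have hcd' : Pi.single i b * e c = e d := by rw [← hcd, map_mul, e.apply_symm_apply]
  have hbd : b * e c i = e d i := by rw [← hcd']; simp
  -- The image of `d` is a multiple of an element supported at `i`.
  have hdi : e d i ≠ 0 := by
    intro h0
    refine hd0 (e.injective ?_)
    rw [map_zero]
    funext j
    by_cases hj : j = i
    · subst hj; exact h0
    · rw [← hcd']; simp [Pi.single_eq_of_ne hj]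
  refine ⟨e c i, map_mem_center (eval_comp_surjective e i) hc, e d i,
    map_mem_center (eval_comp_surjective e i) hd, fun h0 => hdi ?_, hdi, hbd⟩
  rw [← hbd, h0, mul_zero]

theorem IsCentrallyEssential.of_forall_factor (e : A ≃+* ∀ i, B i)
    (h : ∀ i, IsCentrallyEssential (B i)) : IsCentrallyEssential A := by
  classical
  intro a ha
  obtain ⟨i, hi⟩ : ∃ i, e a i ≠ 0 := by
    by_contra! hcon
    exact ha (e.injective (by rw [map_zero]; exact funext hcon))
  obtain ⟨c, hc, d, hd, hc0, hd0, hcd⟩ := h i _ hi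
  have hcen : ∀ x ∈ Subring.center (B i), e.symm (Pi.single i x) ∈ Subring.center A := by
    intro x hx
    rw [Subring.mem_center_iff]
    intro b
    apply e.injective
    rw [map_mul, map_mul, e.apply_symm_apply]
    funext j
    by_cases hj : j = i
    · subst hj; simpa using mul_comm_of_mem_center hx _
    · simp [Pi.single_eq_of_ne hj]
  refine ⟨_, hcen c hc, _, hcen d hd, by simpa using hc0, by simpa using hd0, e.injective ?_⟩
  rw [map_mul, e.apply_symm_apply, e.apply_symm_apply]
  funext j
  by_cases hj : j = i
  · subst hj; simpa using hcd
  · simp [Pi.single_eq_of_ne hj]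

theorem IsDistributiveRing.of_forall_factor (e : A ≃+* ∀ i, B i)
    (h : ∀ i, IsDistributiveRing (B i)) : IsDistributiveRing A := by
  refine ⟨isRightDistributiveRing_iff.2 fun a b => ?_,
    isDistributiveModule_self_iff.2 fun a b => ?_⟩
  · choose x y z h₁ h₂ using fun i => isRightDistributiveRing_iff.1 (h i).1 (e a i) (e b i)
    refine ⟨e.symm x, e.symm y, e.symm z, e.injective ?_, e.injective ?_⟩
    · simp only [map_mul, e.apply_symm_apply]
      exact funext h₁
    · simp only [map_mul, map_sub, map_one, e.apply_symm_apply]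
      exact funext h₂
  · choose x y z h₁ h₂ using fun i => isDistributiveModule_self_iff.1 (h i).2 (e a i) (e b i)
    refine ⟨e.symm x, e.symm y, e.symm z, e.injective ?_, e.injective ?_⟩
    · simp only [map_mul, e.apply_symm_apply]
      exact funext h₁
    · simp only [map_mul, map_sub, map_one, e.apply_symm_apply]
      exact funext h₂

theorem IsTwoSidedNoetherianRing.of_forall_factor [Finite ι] (e : A ≃+* ∀ i, B i)
    (h : ∀ i, IsNoetherianRing (B i)ᵐᵒᵖ) (h' : ∀ i, IsNoetherianRing (B i)) :
    IsTwoSidedNoetherianRing A := by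
  refine ⟨isRightNoetherianRing_iff.2 ?_, isNoetherianRing_of_ringEquiv _ e.symm⟩
  exact isNoetherianRing_of_ringEquiv (∀ i, (B i)ᵐᵒᵖ)
    ((RingEquiv.piMulOpposite B).symm.trans (RingEquiv.op e.symm))

end Products

theorem IsProductOfUniserialArtinianAndDedekind.properties {A : Type u} [Ring A]
    (h : IsProductOfUniserialArtinianAndDedekind A) :
    IsDistributiveRing A ∧ IsTwoSidedNoetherianRing A ∧ IsCentrallyEssential A := by
  obtain ⟨n, B, _, hB, ⟨e⟩⟩ := h
  have key : ∀ i, IsDistributiveRing (B i) ∧ IsNoetherianRing (B i)ᵐᵒᵖ ∧ IsNoetherianRing (B i) ∧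
      IsCentrallyEssential (B i) := by
    intro i
    rcases (hB i).2 with ⟨hu, ha, hc⟩ | hD
    · have : IsArtinianRing (B i) := ha.2
      exact ⟨⟨hu.1.isDistributiveModule, hu.2.isDistributiveModule⟩,
        isNoetherianRing_op_of_isArtinian ha.1, inferInstance, hc⟩
    · exact hD.properties
  exact ⟨.of_forall_factor e fun i => (key i).1,
    .of_forall_factor e (fun i => (key i).2.1) fun i => (key i).2.2.1,
    .of_forall_factor e fun i => (key i).2.2.2⟩

/-! ### Decomposition into indecomposable rings -/

section Decomposition

theorem IsProductOfUniserialArtinianAndDedekind.of_ringEquiv_pi {A : Type u} [Ring A] {ι : Type}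
    [Finite ι] {B : ι → Type u} [∀ i, Ring (B i)] (e : A ≃+* ∀ i, B i)
    (h : ∀ i, IsProductOfUniserialArtinianAndDedekind (B i)) :
    IsProductOfUniserialArtinianAndDedekind A := by
  choose n B' inst hB' e' using h
  have e' := fun i => (e' i).some
  let σ : (Σ i, Fin (n i)) ≃ Fin _ := Finite.equivFin _
  let f : A →+* ∀ k, B' (σ.symm k).1 (σ.symm k).2 := RingHom.pi fun k =>
    (Pi.evalRingHom _ (σ.symm k).2).comp ((e' (σ.symm k).1 : _ →+* _).comp
      ((Pi.evalRingHom B (σ.symm k).1).comp (e : A →+* ∀ i, B i)))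
  refine ⟨_, fun k => B' (σ.symm k).1 (σ.symm k).2, fun k => inst _ _, fun k => hB' _ _,
    ⟨RingEquiv.ofBijective f ⟨?_, ?_⟩⟩⟩
  · rw [injective_iff_map_eq_zero]
    intro a ha
    refine e.injective ?_
    rw [map_zero]
    funext i
    refine (e' i).injective ?_
    rw [Pi.zero_apply, map_zero]
    funext j
    have h₁ : e' (σ.symm (σ ⟨i, j⟩)).1 (e a (σ.symm (σ ⟨i, j⟩)).1) (σ.symm (σ ⟨i, j⟩)).2 = 0 :=
      congrFun ha (σ ⟨i, j⟩)
    rw [σ.symm_apply_apply] at h₁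
    exact h₁
  · intro g
    let g' : ∀ s : Σ i, Fin (n i), B' s.1 s.2 := (Equiv.piCongrLeft' _ σ).symm g
    refine ⟨e.symm fun i => (e' i).symm fun j => g' ⟨i, j⟩, ?_⟩
    funext k
    change e' (σ.symm k).1 (e (e.symm _) (σ.symm k).1) (σ.symm k).2 = g k
    rw [e.apply_symm_apply, RingEquiv.apply_symm_apply]
    exact congrFun
      ((Equiv.piCongrLeft' (fun s : Σ i, Fin (n i) => B' s.1 s.2) σ).apply_symm_apply g) k

theorem isProduct_of_single {A : Type u} [Ring A] [Nontrivial A]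
    (h : (IsUniserialRing A ∧ IsTwoSidedArtinianRing A ∧ IsCentrallyEssential A) ∨
      IsCommutativeDedekindDomain A) : IsProductOfUniserialArtinianAndDedekind A :=
  ⟨1, fun _ => A, fun _ => inferInstance, fun _ => ⟨inferInstance, h⟩,
    ⟨(RingEquiv.piUnique fun _ : Fin 1 => A).symm⟩⟩

/-- The empty product covers the zero ring in the induction; a nontrivial ring forces `n ≥ 1`. -/
theorem isProduct_of_subsingleton {A : Type u} [Ring A] [Subsingleton A] :
    IsProductOfUniserialArtinianAndDedekind A :=
  ⟨0, fun _ => A, fun _ => inferInstance, fun i => i.elim0,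
    ⟨{ toFun := fun _ i => i.elim0
       invFun := fun _ => 0
       left_inv := fun _ => Subsingleton.elim _ _
       right_inv := fun _ => Subsingleton.elim _ _
       map_mul' := fun _ _ => Subsingleton.elim _ _
       map_add' := fun _ _ => Subsingleton.elim _ _ }⟩⟩

theorem IsIndecomposableRDNCE.isProduct {A : Type u} [Ring A] [Nontrivial A]
    (h : IsIndecomposableRDNCE A) : IsProductOfUniserialArtinianAndDedekind A := by
  apply isProduct_of_single
  by_cases hC : ∀ d ∈ Subring.center A, IsNilpotent d → d = 0
  · obtain ⟨hcomm, hdom⟩ := h.comm_domain_of_reduced_center hC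
    exact .inr (isCommutativeDedekindDomain_of_comm_domain hcomm hdom h.noeth h.distrib)
  · push Not at hC
    obtain ⟨k, hk, hkn, hk0⟩ := hC
    obtain ⟨h₁, h₂⟩ :=
      h.isUniserialRing_and_isTwoSidedArtinianRing (h.isNilpotent_or_isUnit hk hkn hk0)
    exact .inl ⟨h₁, h₂, h.ce⟩

/-- The kernel of a ring homomorphism as a right ideal. -/
def rightKer {A B : Type*} [Ring A] [Ring B] (φ : A →+* B) : Submodule Aᵐᵒᵖ A where
  carrier := {x | φ x = 0}
  add_mem' {x y} hx hy := by
    change φ (x + y) = 0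
    rw [map_add, show φ x = 0 from hx, show φ y = 0 from hy, add_zero]
  zero_mem' := map_zero φ
  smul_mem' a x hx := by
    change φ (x * a.unop) = 0
    rw [map_mul, show φ x = 0 from hx, zero_mul]

/-- Representing every factor as a quotient of the fixed ring `A` allows Noetherian induction on
kernels. Central essentiality is assumed of `B` because it passes to direct factors, not to
arbitrary quotients. -/
theorem isProduct_of_surjective {A : Type u} [Ring A] (hd : IsRightDistributiveRing A)
    (hN : IsRightNoetherianRing A) (K : Submodule Aᵐᵒᵖ A) :
    ∀ (B : Type u) [Ring B] (φ : A →+* B), Function.Surjective φ → rightKer φ = K →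
      IsCentrallyEssential B → IsProductOfUniserialArtinianAndDedekind B := by
  have : IsNoetherian Aᵐᵒᵖ A := hN
  induction K using IsNoetherian.induction with
  | hgt K ih =>
  intro B _ φ hφ hK hc
  rcases subsingleton_or_nontrivial B with hB | hB
  · exact isProduct_of_subsingleton
  by_cases hidem : ∀ e : B, e * e = e → e = 0 ∨ e = 1
  · exact IsIndecomposableRDNCE.isProduct
      ⟨isRightDistributiveRing_iff.1 (hd.of_surjective hφ), hN.of_surjective hφ, hc, hidem⟩
  push Not at hidem
  obtain ⟨e, he, he0, he1⟩ := hidem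
  have hcoi : CompleteOrthogonalIdempotents ![e, 1 - e] :=
    .of_isIdempotentElem he
  have hcen : ∀ i, IsMulCentral (![e, 1 - e] i) := fun i =>
    Semigroup.mem_center_iff.2 fun b => (hc.commute_of_isIdempotentElem (hcoi.idem i) b).symm
  let E := hcoi.ringEquivOfIsMulCentral hcen
  refine .of_ringEquiv_pi E fun i => ?_
  let ψ : A →+* (hcoi.idem i).Corner :=
    ((Pi.evalRingHom (fun i => (hcoi.idem i).Corner) i).comp (E : B →+* _)).comp φ
  have hψ : Function.Surjective ψ := (eval_comp_surjective E i).comp hφ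
  refine ih (rightKer ψ) ?_ _ ψ hψ rfl (hc.of_ringEquiv_pi E i)
  have hne : ∀ i, ![e, 1 - e] i ≠ 1 := by
    rw [Fin.forall_fin_two]
    exact ⟨he1, fun h => he0 (by simpa using h)⟩
  refine lt_of_le_of_ne ?_ ?_
  · intro x hx
    rw [← hK] at hx
    change E (φ x) i = 0
    rw [show φ x = 0 from hx, map_zero, Pi.zero_apply]
  · intro heq
    -- A lift of the complementary idempotent lies in the new kernel but not in the old one.
    obtain ⟨x, hx⟩ := hφ (1 - ![e, 1 - e] i)
    have hxK : x ∈ K := by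
      rw [heq]
      change E (φ x) i = 0
      refine Subtype.ext ?_
      change ![e, 1 - e] i * φ x * ![e, 1 - e] i = 0
      rw [hx, mul_sub, mul_one, (hcoi.idem i).eq, sub_self, zero_mul]
    rw [← hK] at hxK
    exact hne i (sub_eq_zero.1 (hx.symm.trans hxK)).symm

end Decomposition

theorem proposition2p7 (A : Type u) [Ring A] [Nontrivial A] :
    ((IsRightDistributiveRing A ∧ IsRightNoetherianRing A ∧ IsCentrallyEssential A) ↔
      IsProductOfUniserialArtinianAndDedekind A) ∧
    (IsProductOfUniserialArtinianAndDedekind A →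
      IsDistributiveRing A ∧ IsTwoSidedNoetherianRing A) := by
  refine ⟨⟨fun ⟨hd, hN, hc⟩ => ?_, fun h => ?_⟩, fun h => ⟨h.properties.1, h.properties.2.1⟩⟩
  · exact isProduct_of_surjective hd hN _ A (RingHom.id A) Function.surjective_id rfl hc
  · exact ⟨h.properties.1.1, h.properties.2.1.1, h.properties.2.2⟩
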